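/- Let $G$ and $H$ be free groups of finite rank with fixed free bases $a_1,\dots,a_n$ of $G$ and $b_1,\dots,b_m$ of $H$, where $m>1$. For $w\in H$ let $|w|$ be the reduced word length of $w$ in the basis $b_1,\dots,b_m$, and let $H_p=\{w\in H : |w|\le p\}$. A set $S\subseteq H^l$ is called generic if \[ \lim_{p\to\infty}\frac{|S\cap (H_p)^l|}{|(H_p)^l|}=1 . \] A triple $(\phi,u,v)$, where $\phi:G\to H$ is a homomorphism and $u,v\in H$, is identified with the $(n+2)$-tuple $(\phi(a_1),\dots,\phi(a_n),u,v)\in H^{n+2}$, and a set of such triples is called generic if the corresponding subset of $H^{n+2}$ is generic. (When $G=H$, the basis $b_1,\dots,b_m$ is used for both groups.) Then: (i) For endomorphisms $\phi:H\to H$, let $[u]$ denote the singly-twisted conjugacy class of $u\in H$ with respect to $\phi$, so that $[u]=[v]$ if and only if $u=\phi(z)\,v\,z^{-1}$ for some $z\in H$. The set \[ \{(\phi,u,v)\mid [u]\ne[v]\} \] of triples with $\phi:H\to H$ an endomorphism and $u,v\in H$ is generic. (ii) For homomorphisms $\phi:G\to H$, the set \[ \{(\phi,u,v)\mid uv^{-1}\notin\phi(G)\}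 \] of triples with $\phi:G\to H$ a homomorphism and $u,v\in H$ is generic. -/

import Mathlib

open Filter Topology

/-- The doubly-twisted conjugacy relation on `H` with respect to `φ, ψ : G → H`:
`u` and `v` are related iff `u = φ(z) v ψ(z)⁻¹` for some `z ∈ G`. -/
def twistedConj {G H : Type*} [Group G] [Group H] (φ ψ : G →* H) : Setoid H where
  r u v := ∃ z : G, u = φ z * v * (ψ z)⁻¹
  iseqv :=
    { refl := fun u => ⟨1, by simp⟩
      symm := by
        rintro u v ⟨z, rfl⟩
        exact ⟨z⁻¹, by simp [mul_assoc]⟩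
      trans := by
        rintro u v w ⟨z, rfl⟩ ⟨y, rfl⟩
        exact ⟨z * y, by simp [mul_assoc]⟩ }

/-- The doubly-twisted conjugacy class `[u]` of `u` with respect to `φ, ψ`. -/
def twistedConjClass {G H : Type*} [Group G] [Group H] (φ ψ : G →* H) (u : H) :
    Quotient (twistedConj φ ψ) :=
  Quotient.mk (twistedConj φ ψ) u

/-- The singly-twisted conjugacy class `[u]` of `u` with respect to the endomorphism `φ`:
the second homomorphism is the identity. -/
def singlyTwistedConjClass {H : Type*} [Group H] (φ : H →* H) (u : H) :
    Quotient (twistedConj φ (MonoidHom.id H)) :=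
  twistedConjClass φ (MonoidHom.id H) u

open Classical in
/-- The reduced word length `|w|` of `w ∈ H` with respect to the free basis `b`. -/
noncomputable def wordLength {κ H : Type*} [Group H] (b : FreeGroupBasis κ H) (w : H) : ℕ :=
  (b.repr w).norm

/-- `(H_p)^τ`: the tuples indexed by `τ` all of whose entries have word length at most `p`. -/
def tupleBall {κ H : Type*} [Group H] (b : FreeGroupBasis κ H) (τ : Type*) (p : ℕ) :
    Set (τ → H) :=
  {t | ∀ i, wordLength b (t i) ≤ p}

/-- The asymptotic density of the set `S ⊆ H^τ` of tuples exists and equals `d`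
(intended for `b` and `τ` finite, so that all the cardinalities are finite). -/
def HasAsymptoticDensity {κ H τ : Type*} [Group H] (b : FreeGroupBasis κ H)
    (S : Set (τ → H)) (d : ℝ) : Prop :=
  Tendsto (fun p : ℕ => ((S ∩ tupleBall b τ p).ncard : ℝ) / ((tupleBall b τ p).ncard : ℝ))
    atTop (𝓝 d)

/-- A set of tuples is generic if its asymptotic density is `1`. -/
def IsGenericTuples {κ H τ : Type*} [Group H] (b : FreeGroupBasis κ H)
    (S : Set (τ → H)) : Prop :=
  HasAsymptoticDensity b S 1

/-- A triple `(φ, u, v)` with `φ : G → H` and `u, v ∈ H`, viewed as the `(n + 2)`-tuple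
`(φ(a₁), …, φ(aₙ), u, v)` of elements of `H`, where `a` is the given free basis of `G`. -/
def tripleTuple {ι G H : Type*} [Group G] [Group H] (a : FreeGroupBasis ι G)
    (T : (G →* H) × H × H) : ι ⊕ Fin 2 → H :=
  Sum.elim (fun i => T.1 (a i)) ![T.2.1, T.2.2]

/-- A set of triples `(φ, u, v)` is generic if the corresponding set of `(n + 2)`-tuples is. -/
def IsGenericTriples {ι κ G H : Type*} [Group G] [Group H] (a : FreeGroupBasis ι G)
    (b : FreeGroupBasis κ H) (S : Set ((G →* H) × H × H)) : Prop :=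
  IsGenericTuples b (tripleTuple a '' S)

/-- Two reduced words multiply by cancelling a suffix of the first against a prefix of the
second. -/
theorem FreeGroup.IsReduced.exists_cancel {α : Type*} {L₁ L₂ : List (α × Bool)}
    (h₁ : FreeGroup.IsReduced L₁) (h₂ : FreeGroup.IsReduced L₂) :
    ∃ A C B, L₁ = A ++ C ∧ L₂ = FreeGroup.invRev C ++ B ∧ FreeGroup.IsReduced (A ++ B) := by
  induction L₂ generalizing L₁ with
  | nil => exact ⟨L₁, [], [], by simp, by simp, by simpa using h₁⟩
  | cons y L₂ ih =>
    rcases List.eq_nil_or_concat L₁ with rfl | ⟨L, x, rfl⟩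
    · exact ⟨[], [], y :: L₂, by simp, by simp, by simpa using h₂⟩
    by_cases hxy : x.1 = y.1 → x.2 = y.2
    · refine ⟨L ++ [x], [], y :: L₂, by simp, by simp, ?_⟩
      refine List.isChain_append.2 ⟨(by simpa using h₁ : FreeGroup.IsReduced (L ++ [x])), h₂, ?_⟩
      simpa using hxy
    · obtain ⟨A, C, B, rfl, rfl, h⟩ := ih (L₁ := L)
        (h₁.infix ⟨[], [x], by simp⟩) (h₂.infix ⟨[y], [], by simp⟩)
      refine ⟨A, C ++ [x], B, by simp, ?_, h⟩
      have : y = (x.1, !x.2) := by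
        obtain ⟨x, e⟩ := x
        obtain ⟨y, e'⟩ := y
        cases e <;> cases e' <;> simp_all
      simp [this, FreeGroup.invRev]

/-- If `x⁻¹` and `y` have distinct prefixes of length `c`, then fewer than `c` letters cancel
in the product `x * y`. -/
theorem FreeGroup.exists_toWord_mul {α : Type*} [DecidableEq α] {x y : FreeGroup α} {c : ℕ}
    (h : x⁻¹.toWord.take c ≠ y.toWord.take c) :
    ∃ A C B, x.toWord = A ++ C ∧ y.toWord = FreeGroup.invRev C ++ B ∧
      (x * y).toWord = A ++ B ∧ C.length < c := by
  obtain ⟨A, C, B, hx, hy, hr⟩ :=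
    (FreeGroup.isReduced_toWord (x := x)).exists_cancel (FreeGroup.isReduced_toWord (x := y))
  refine ⟨A, C, B, hx, hy, ?_, ?_⟩
  · rw [← hr.reduce_eq, ← FreeGroup.toWord_mk]
    congr 1
    rw [← FreeGroup.mk_toWord (x := x), ← FreeGroup.mk_toWord (x := y), hx, hy]
    simp only [← FreeGroup.mul_mk, ← FreeGroup.inv_mk]
    group
  · by_contra! hc
    apply h
    rw [FreeGroup.toWord_inv, hx, hy, FreeGroup.invRev_append,
      List.take_append_of_le_length (by simpa using hc),
      List.take_append_of_le_length (by simpa using hc)]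

/-- Small cancellation: if the words `W s` and `v` are long and have pairwise distinct short
prefixes, then the length of a product along a reduced word grows linearly. -/
theorem FreeGroup.le_norm_prod_mul {α κ : Type*} [DecidableEq κ]
    {W : α × Bool → FreeGroup κ} {v : FreeGroup κ} {c l : ℕ} (hcl : 2 * c ≤ l)
    (hinv : ∀ s, W (s.1, !s.2) = (W s)⁻¹) (hl : ∀ s, l ≤ (W s).norm) (hv : l ≤ v.norm)
    (hW : ∀ s s', s ≠ s' → (W s).toWord.take c ≠ (W s').toWord.take c)
    (hWv : ∀ s, (W s).toWord.take c ≠ v.toWord.take c)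
    {L : List (α × Bool)} (hL : FreeGroup.IsReduced L) :
    l + L.length * (l - 2 * c) ≤ ((L.map W).prod * v).norm ∧
      ∀ s ∈ L.head?, ((L.map W).prod * v).toWord.take c = (W s).toWord.take c := by
  induction L with
  | nil => simpa using hv
  | cons s L ih =>
    obtain ⟨ih₁, ih₂⟩ := ih (hL.infix ⟨[s], [], by simp⟩)
    have hne : (W s)⁻¹.toWord.take c ≠ ((L.map W).prod * v).toWord.take c := by
      rw [← hinv]
      cases L with
      | nil => simpa using hWv _
      | cons r L =>
        rw [ih₂ r (by simp)]
        refine hW _ _ fun h => ?_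
        have := (FreeGroup.isReduced_cons_cons.1 hL).1
        simp [← h] at this
    obtain ⟨A, C, B, hA, hB, hAB, hC⟩ := FreeGroup.exists_toWord_mul hne
    have hs := hl s
    rw [List.map_cons, List.prod_cons, mul_assoc]
    simp only [FreeGroup.norm, hA, hB, hAB, List.length_append, FreeGroup.invRev_length,
      List.length_cons, add_mul, one_mul] at hs ih₁ ⊢
    refine ⟨by omega, fun s' hs' => ?_⟩
    obtain rfl : s = s' := by simpa using hs'
    rw [hA, List.take_append_of_le_length (by omega), List.take_append_of_le_length (by omega)]

/-- The reduced words of length at most `p`. -/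
def reducedWords (κ : Type*) (p : ℕ) : Set (List (κ × Bool)) :=
  {L | FreeGroup.IsReduced L ∧ L.length ≤ p}

theorem reducedWords_finite (κ : Type*) [Finite κ] (p : ℕ) : (reducedWords κ p).Finite :=
  (List.finite_length_le (κ × Bool) p).subset fun _ h => h.2

theorem two_mul_ncard_reducedWords_le {κ : Type*} [Finite κ] [Nontrivial κ] (p : ℕ) :
    2 * (reducedWords κ p).ncard ≤ (reducedWords κ (p + 1)).ncard := by
  classical
  obtain ⟨x, y, hxy⟩ := exists_pair_ne κ
  have h := Set.ncard_le_ncard_of_injOn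
    (s := (Set.univ : Set Bool) ×ˢ reducedWords κ p) (t := reducedWords κ (p + 1))
    (fun q => (if q.2.head?.map Prod.fst = some x then y else x, q.1) :: q.2) ?_ ?_
    (reducedWords_finite κ _)
  · simpa [Set.ncard_prod, Set.ncard_univ] using h
  · rintro ⟨e, L⟩ ⟨-, hL, hp⟩
    refine ⟨?_, by simpa using hp⟩
    cases L with
    | nil => simp
    | cons z L =>
      refine FreeGroup.isReduced_cons_cons.2 ⟨fun h => ?_, hL⟩
      by_cases hz : z.1 = x
      · simp [hz] at h
        exact absurd h.symm hxy
      · simp [hz] at h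
        exact absurd h.symm hz
  · rintro ⟨e, L⟩ - ⟨e', L'⟩ - h
    simp only [List.cons.injEq, Prod.mk.injEq] at h
    simp [h]

theorem two_pow_mul_ncard_reducedWords_le {κ : Type*} [Finite κ] [Nontrivial κ] (p c : ℕ) :
    2 ^ c * (reducedWords κ p).ncard ≤ (reducedWords κ (p + c)).ncard := by
  induction c with
  | zero => simp
  | succ c ih =>
    have := two_mul_ncard_reducedWords_le (κ := κ) (p + c)
    rw [← add_assoc, pow_succ]
    linarith

/-- If, for every choice of the coordinates other than `j`, at most `K` values in `B` of the
`j`-th coordinate give a point of `E`, then `E` has proportion at most `K / |B|` in the box. -/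
theorem Set.ncard_mul_ncard_le_of_update {τ H : Type*} [Finite τ] [DecidableEq τ] {B : Set H}
    (hB : B.Finite) {E : Set (τ → H)} (hE : E ⊆ {t | ∀ i, t i ∈ B}) (j : τ) {K : ℕ}
    (hK : ∀ t, {y | y ∈ B ∧ Function.update t j y ∈ E}.ncard ≤ K) :
    E.ncard * B.ncard ≤ K * {t : τ → H | ∀ i, t i ∈ B}.ncard := by
  have hfin : {t : τ → H | ∀ i, t i ∈ B}.Finite := by
    simpa [Set.pi] using Set.Finite.pi' (fun _ : τ => hB)
  set F : (τ → H) → Set ((τ → H) × H) := fun t =>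
    Prod.mk t '' {y | y ∈ B ∧ Function.update t j y ∈ E}
  have h₁ : (E ×ˢ B).ncard ≤ (⋃ t ∈ hfin.toFinset, F t).ncard := by
    refine Set.ncard_le_ncard_of_injOn (fun q => (Function.update q.1 j q.2, q.1 j)) ?_ ?_ ?_
    · rintro ⟨t, y⟩ ⟨ht, hy⟩
      simp only [Set.mem_iUnion]
      refine ⟨Function.update t j y, ?_, t j, ⟨hE ht j, by simpa using ht⟩, rfl⟩
      simp only [Set.Finite.mem_toFinset, Set.mem_ofPred_eq]
      intro i
      by_cases hi : i = j
      · subst hi; simpa using hy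
      · simpa [hi] using hE ht i
    · rintro ⟨t, y⟩ - ⟨t', y'⟩ - h
      simp only [Prod.mk.injEq] at h
      have hy : y = y' := by simpa using congrFun h.1 j
      refine Prod.ext (funext fun i => ?_) hy
      by_cases hi : i = j
      · subst hi; exact h.2
      · simpa [hi] using congrFun h.1 i
    · exact hfin.toFinset.finite_toSet.biUnion fun t _ => (hB.subset fun _ h => h.1).image _
  calc E.ncard * B.ncard = (E ×ˢ B).ncard := Set.ncard_prod.symm
    _ ≤ _ := h₁
    _ ≤ ∑ t ∈ hfin.toFinset, (F t).ncard := Finset.set_ncard_biUnion_le _ _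
    _ ≤ ∑ t ∈ hfin.toFinset, K := by
        refine Finset.sum_le_sum fun t _ => ?_
        rw [Set.ncard_image_of_injective _ (Prod.mk_right_injective t)]
        exact hK t
    _ = K * {t : τ → H | ∀ i, t i ∈ B}.ncard := by
        rw [Finset.sum_const, smul_eq_mul, mul_comm, Set.ncard_eq_toFinset_card _ hfin]

section Balls

variable {κ H τ : Type*} [Group H] (b : FreeGroupBasis κ H)

open Classical in
/-- The reduced word representing `y` in the free basis `b`. -/
noncomputable def basisWord (y : H) : List (κ × Bool) :=
  (b.repr y).toWord

theorem length_basisWord (y : H) : (basisWord b y).length = wordLength b y := rfl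

open Classical in
theorem basisWord_injective : Function.Injective (basisWord b) :=
  FreeGroup.toWord_injective.comp b.repr.injective

open Classical in
theorem isReduced_basisWord (y : H) : FreeGroup.IsReduced (basisWord b y) :=
  FreeGroup.isReduced_toWord

open Classical in
theorem basisWord_inv (y : H) : basisWord b y⁻¹ = FreeGroup.invRev (basisWord b y) := by
  simp [basisWord, FreeGroup.toWord_inv]

theorem wordLength_inv (y : H) : wordLength b y⁻¹ = wordLength b y := by
  simp [wordLength]

open Classical in
theorem wordLength_mul_le (x y : H) :
    wordLength b (x * y) ≤ wordLength b x + wordLength b y := by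
  simpa [wordLength] using FreeGroup.norm_mul_le (b.repr x) (b.repr y)

open Classical in
theorem image_basisWord_ball (p : ℕ) :
    basisWord b '' {y | wordLength b y ≤ p} = reducedWords κ p := by
  ext L
  constructor
  · rintro ⟨y, hy, rfl⟩
    exact ⟨isReduced_basisWord b y, hy⟩
  · rintro ⟨hL, hp⟩
    have : basisWord b (b.repr.symm (FreeGroup.mk L)) = L := by
      simp [basisWord, hL.reduce_eq]
    refine ⟨_, ?_, this⟩
    rwa [Set.mem_ofPred_eq, ← length_basisWord, this]

theorem ncard_ball (p : ℕ) :
    {y | wordLength b y ≤ p}.ncard = (reducedWords κ p).ncard := by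
  rw [← image_basisWord_ball b, Set.ncard_image_of_injective _ (basisWord_injective b)]

theorem finite_ball [Finite κ] (p : ℕ) : {y | wordLength b y ≤ p}.Finite := by
  refine Set.Finite.of_finite_image ?_ (basisWord_injective b).injOn
  rw [image_basisWord_ball]
  exact reducedWords_finite κ p

theorem finite_tupleBall [Finite κ] [Finite τ] (p : ℕ) : (tupleBall b τ p).Finite := by
  simpa [tupleBall] using Set.Finite.pi' (fun _ : τ => finite_ball b p)

theorem tupleBall_ncard_pos [Finite κ] [Finite τ] (p : ℕ) : 0 < (tupleBall b τ p).ncard :=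
  (Set.ncard_pos (finite_tupleBall b p)).2 ⟨fun _ => 1, fun _ => by simp [wordLength]⟩

/-- The elements `x` and `x⁻¹`, according to the sign. -/
def signedElement (x : H) (e : Bool) : H := cond e x x⁻¹

theorem signedElement_injective (e : Bool) : Function.Injective fun x : H => signedElement x e := by
  cases e
  · exact inv_injective
  · exact Function.injective_id

theorem signedElement_not (x : H) (e : Bool) : signedElement x (!e) = (signedElement x e)⁻¹ := by
  cases e <;> simp [signedElement]

theorem wordLength_signedElement (x : H) (e : Bool) :
    wordLength b (signedElement x e) = wordLength b x := by
  cases e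
  · exact wordLength_inv b x
  · rfl

/-- Words whose prefix of length `c` is determined by the rest are few. -/
theorem ncard_le_of_take_eq [Finite κ] {p c : ℕ} (e : Bool) {S : Set H}
    (F : List (κ × Bool) → List (κ × Bool))
    (hp : ∀ y ∈ S, wordLength b y ≤ p)
    (hF : ∀ y ∈ S, (basisWord b (signedElement y e)).take c =
      F ((basisWord b (signedElement y e)).drop c)) :
    S.ncard ≤ (reducedWords κ (p - c)).ncard := by
  refine Set.ncard_le_ncard_of_injOn (fun y => (basisWord b (signedElement y e)).drop c) ?_ ?_
    (reducedWords_finite κ _)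
  · intro y hy
    refine ⟨(isReduced_basisWord b _).infix (List.drop_suffix _ _).isInfix, ?_⟩
    have := hp y hy
    rw [List.length_drop, length_basisWord, wordLength_signedElement]
    omega
  · intro y hy y' hy' h
    apply signedElement_injective e
    apply basisWord_injective b
    dsimp only at h
    rw [← List.take_append_drop c (basisWord b (signedElement y e)), hF y hy, h, ← hF y' hy',
      List.take_append_drop]

/-- The tuples in the ball of radius `p` whose `j`-th entry has length less than `p - c`. -/
def shortTuples (τ : Type*) (p c : ℕ) (j : τ) : Set (τ → H) :=
  {t | t ∈ tupleBall b τ p ∧ wordLength b (t j) + c < p}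

/-- The tuples in the ball of radius `p` two of whose signed entries share a prefix
of length `c`. -/
def collidingTuples (τ : Type*) (p c : ℕ) (s s' : τ × Bool) : Set (τ → H) :=
  {t | t ∈ tupleBall b τ p ∧ s ≠ s' ∧ 2 * c ≤ wordLength b (t s'.1) ∧
    (basisWord b (signedElement (t s.1) s.2)).take c =
      (basisWord b (signedElement (t s'.1) s'.2)).take c}

theorem ncard_mul_two_pow_le_of_update [Finite κ] [Nontrivial κ] [Finite τ] [DecidableEq τ]
    {p c : ℕ} (hc : c ≤ p) {E : Set (τ → H)} (hE : E ⊆ tupleBall b τ p) (j : τ)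
    (hK : ∀ t, {y | wordLength b y ≤ p ∧ Function.update t j y ∈ E}.ncard ≤
      (reducedWords κ (p - c)).ncard) :
    E.ncard * 2 ^ c ≤ (tupleBall b τ p).ncard := by
  have h₁ := Set.ncard_mul_ncard_le_of_update (finite_ball b p) hE j hK
  have h₂ := two_pow_mul_ncard_reducedWords_le (κ := κ) (p - c) c
  rw [Nat.sub_add_cancel hc] at h₂
  rw [ncard_ball] at h₁
  have h₃ : 0 < (reducedWords κ p).ncard :=
    (Set.ncard_pos (reducedWords_finite κ p)).2 ⟨[], by simp [reducedWords]⟩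
  refine Nat.le_of_mul_le_mul_right ?_ h₃
  calc E.ncard * 2 ^ c * (reducedWords κ p).ncard
      = 2 ^ c * (E.ncard * (reducedWords κ p).ncard) := by ring
    _ ≤ 2 ^ c * ((reducedWords κ (p - c)).ncard * (tupleBall b τ p).ncard) := by
        exact Nat.mul_le_mul_left _ h₁
    _ = 2 ^ c * (reducedWords κ (p - c)).ncard * (tupleBall b τ p).ncard := by ring
    _ ≤ (reducedWords κ p).ncard * (tupleBall b τ p).ncard := by gcongr
    _ = _ := mul_comm _ _

theorem ncard_shortTuples_mul_le [Finite κ] [Nontrivial κ] [Finite τ]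
    {p c : ℕ} (hc : c ≤ p) (j : τ) :
    (shortTuples b τ p c j).ncard * 2 ^ c ≤ (tupleBall b τ p).ncard := by
  classical
  refine ncard_mul_two_pow_le_of_update b hc (fun t h => h.1) j fun t => ?_
  rw [← ncard_ball b]
  refine Set.ncard_le_ncard ?_ (finite_ball b _)
  rintro y ⟨-, -, hy⟩
  rw [Function.update_self] at hy
  simp only [Set.mem_ofPred_eq]
  omega

theorem ncard_collidingTuples_mul_le [Finite κ] [Nontrivial κ] [Finite τ]
    {p c : ℕ} (hc : c ≤ p) (s s' : τ × Bool) :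
    (collidingTuples b τ p c s s').ncard * 2 ^ c ≤ (tupleBall b τ p).ncard := by
  classical
  refine ncard_mul_two_pow_le_of_update b hc (fun t h => h.1) s'.1 fun t => ?_
  by_cases hj : s.1 = s'.1
  · refine ncard_le_of_take_eq b s'.2 (fun D => (FreeGroup.invRev D).take c)
      (fun y hy => hy.1) ?_
    rintro y ⟨-, -, hne, hl, h⟩
    rw [hj, Function.update_self] at h
    rw [Function.update_self] at hl
    have hs : s.2 = !s'.2 := by
      have : s.2 ≠ s'.2 := fun h' => hne (Prod.ext hj h')
      revert this
      cases s.2 <;> cases s'.2 <;> simp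
    rw [hs, signedElement_not, basisWord_inv] at h
    rw [← h]
    conv_lhs => rw [← List.take_append_drop c (basisWord b (signedElement y s'.2))]
    rw [FreeGroup.invRev_append, List.take_append_of_le_length]
    rw [FreeGroup.invRev_length, List.length_drop, length_basisWord, wordLength_signedElement]
    omega
  · refine ncard_le_of_take_eq b s'.2 (fun _ => (basisWord b (signedElement (t s.1) s.2)).take c)
      (fun y hy => hy.1) ?_
    rintro y ⟨-, -, -, -, h⟩
    rw [Function.update_self, Function.update_of_ne hj] at h
    exact h.symm

/-- A set of tuples containing all tuples in the ball of radius `p` whose entries are long and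
have distinct short prefixes is generic. -/
theorem isGenericTuples_of_long_of_distinct_prefixes [Fintype κ] [Nontrivial κ] [Fintype τ]
    {S : Set (τ → H)}
    (hS : ∀ p c, 1 ≤ c → 6 * c ≤ p → ∀ t ∈ tupleBall b τ p,
      (∀ j, p - c ≤ wordLength b (t j)) →
      (∀ s s' : τ × Bool, s ≠ s' → (basisWord b (signedElement (t s.1) s.2)).take c ≠
        (basisWord b (signedElement (t s'.1) s'.2)).take c) → t ∈ S) :
    IsGenericTuples b S := by
  classical
  set N : ℕ := Fintype.card τ + Fintype.card ((τ × Bool) × (τ × Bool)) with hN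
  have key : ∀ p, 6 ≤ p → (tupleBall b τ p \ S).ncard * 2 ^ (p / 6) ≤
      N * (tupleBall b τ p).ncard := by
    intro p hp
    set c := p / 6 with hc
    have hcp : 6 * c ≤ p := by omega
    have hsub : tupleBall b τ p \ S ⊆ (⋃ j ∈ (Finset.univ : Finset τ), shortTuples b τ p c j) ∪
        ⋃ q ∈ (Finset.univ : Finset ((τ × Bool) × (τ × Bool))),
          collidingTuples b τ p c q.1 q.2 := by
      rintro t ⟨ht, htS⟩
      by_contra hbad
      simp only [Finset.mem_univ, Set.iUnion_true, Set.mem_union, Set.mem_iUnion, not_or,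
        not_exists] at hbad
      obtain ⟨h₁, h₂⟩ := hbad
      have hlong : ∀ j, p - c ≤ wordLength b (t j) := by
        intro j
        by_contra hj
        exact h₁ j ⟨ht, by omega⟩
      refine htS (hS p c (by omega) hcp t ht hlong fun s s' hne h => h₂ (s, s') ⟨ht, hne, ?_, h⟩)
      have := hlong s'.1
      simp only
      omega
    have hfin := finite_tupleBall (τ := τ) b p
    have hle := Set.ncard_le_ncard hsub <|
      (Finset.univ.finite_toSet.biUnion fun j _ => hfin.subset fun t h => h.1).union
        (Finset.univ.finite_toSet.biUnion fun q _ => hfin.subset fun t h => h.1)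
    calc (tupleBall b τ p \ S).ncard * 2 ^ c
        ≤ (∑ j, (shortTuples b τ p c j).ncard +
            ∑ q : (τ × Bool) × (τ × Bool), (collidingTuples b τ p c q.1 q.2).ncard) * 2 ^ c := by
          gcongr
          exact hle.trans ((Set.ncard_union_le _ _).trans
            (add_le_add (Finset.set_ncard_biUnion_le _ _) (Finset.set_ncard_biUnion_le _ _)))
      _ ≤ ∑ j : τ, (tupleBall b τ p).ncard +
            ∑ q : (τ × Bool) × (τ × Bool), (tupleBall b τ p).ncard := by
          rw [add_mul, Finset.sum_mul, Finset.sum_mul]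
          gcongr with j _ q _
          · exact ncard_shortTuples_mul_le b (by omega) j
          · exact ncard_collidingTuples_mul_le b (by omega) _ _
      _ = N * (tupleBall b τ p).ncard := by
          simp only [Finset.sum_const, smul_eq_mul, Finset.card_univ, hN, add_mul]
  have hlim : Tendsto (fun p : ℕ => 1 - (N : ℝ) * (1 / 2) ^ (p / 6)) atTop (𝓝 1) := by
    have h := ((tendsto_pow_atTop_nhds_zero_of_lt_one (r := (1 / 2 : ℝ)) (by norm_num)
      (by norm_num)).comp (Nat.tendsto_div_const_atTop (n := 6) (by norm_num))).const_mul (N : ℝ)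
    simpa using h.const_sub 1
  refine tendsto_of_tendsto_of_tendsto_of_le_of_le' hlim tendsto_const_nhds ?_ ?_
  · filter_upwards [eventually_ge_atTop 6] with p hp
    have hpos : (0 : ℝ) < (tupleBall b τ p).ncard := by exact_mod_cast tupleBall_ncard_pos b p
    have hsum := Set.ncard_inter_add_ncard_sdiff_eq_ncard (tupleBall b τ p) S
      (finite_tupleBall b p)
    rw [Set.inter_comm] at hsum
    have hk : ((tupleBall b τ p \ S).ncard : ℝ) * 2 ^ (p / 6) ≤ N * (tupleBall b τ p).ncard := by
      exact_mod_cast key p hp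
    have hsum' : ((S ∩ tupleBall b τ p).ncard : ℝ) + (tupleBall b τ p \ S).ncard =
        (tupleBall b τ p).ncard := by exact_mod_cast hsum
    rw [le_div_iff₀ hpos, ← hsum', sub_mul, one_mul, hsum']
    rw [one_div, inv_pow, mul_right_comm]
    have h2 : (0 : ℝ) < 2 ^ (p / 6) := by positivity
    have := (le_div_iff₀ h2).2 hk
    rw [div_eq_mul_inv] at this
    linarith
  · refine Eventually.of_forall fun p => ?_
    have hpos : (0 : ℝ) < (tupleBall b τ p).ncard := by exact_mod_cast tupleBall_ncard_pos b p
    rw [div_le_one hpos]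
    exact_mod_cast Set.ncard_le_ncard Set.inter_subset_right (finite_tupleBall b p)

end Balls

theorem wordLength_map_mul_gt {ι κ G H : Type*} [Group G] [Group H]
    (a : FreeGroupBasis ι G) (b : FreeGroupBasis κ H) (φ : G →* H) (v : H) {p c : ℕ}
    (hc : 1 ≤ c) (hp : 6 * c ≤ p) (hφ : ∀ i, p - c ≤ wordLength b (φ (a i)))
    (hv : p - c ≤ wordLength b v)
    (hW : ∀ s s' : ι × Bool, s ≠ s' → (basisWord b (signedElement (φ (a s.1)) s.2)).take c ≠
      (basisWord b (signedElement (φ (a s'.1)) s'.2)).take c)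
    (hWv : ∀ s : ι × Bool, (basisWord b (signedElement (φ (a s.1)) s.2)).take c ≠
      (basisWord b v).take c)
    {z : G} (hz : z ≠ 1) :
    p + wordLength a z < wordLength b (φ z * v) := by
  classical
  set W : ι × Bool → FreeGroup κ := fun s => b.repr (signedElement (φ (a s.1)) s.2) with hWdef
  have h := (FreeGroup.le_norm_prod_mul (W := W) (v := b.repr v) (c := c) (l := p - c)
    (by omega) (fun s => by simp [hWdef, signedElement_not])
    (fun s => by simpa [hWdef, wordLength_signedElement, wordLength] using
      (hφ s.1).trans_eq (wordLength_signedElement b _ s.2).symm)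
    hv hW hWv (isReduced_basisWord a z)).1
  have hprod : ((basisWord a z).map W).prod = b.repr (φ z) := by
    have hom : (FreeGroup.lift fun i => b.repr (φ (a i))) =
        (b.repr.toMonoidHom.comp φ).comp a.repr.symm.toMonoidHom := by
      ext i
      simp
      rfl
    have := congrArg (fun f => f (a.repr z)) hom
    simp only [MonoidHom.comp_apply, MulEquiv.toMonoidHom_eq_coe, MonoidHom.coe_coe,
      MulEquiv.symm_apply_apply] at this
    rw [← this, ← FreeGroup.mk_toWord (x := a.repr z), FreeGroup.lift_mk]
    congr 1
    refine List.map_congr_left fun s _ => ?_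
    rcases s with ⟨i, _ | _⟩ <;> simp [hWdef, signedElement]
  rw [hprod, ← map_mul, length_basisWord] at h
  have hz' : 1 ≤ wordLength a z := by
    rw [Nat.one_le_iff_ne_zero]
    simpa [wordLength] using hz
  change _ ≤ wordLength b (φ z * v) at h
  have h4 : wordLength a z * (c + 2) ≤ wordLength a z * (p - c - 2 * c) :=
    Nat.mul_le_mul_left _ (by omega)
  nlinarith [Nat.sub_add_cancel (show c ≤ p by omega)]

/-- A set of triples containing every `(φ, u, v)` with `u ≠ v` and
`|u| + |z| < |φ(z) v|` for all `z ≠ 1` is generic. -/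
theorem isGenericTriples_of_wordLength_lt {ι κ G H : Type*} [Group G] [Group H] [Fintype ι]
    [Fintype κ] [Nontrivial κ] (a : FreeGroupBasis ι G) (b : FreeGroupBasis κ H)
    {S : Set ((G →* H) × H × H)}
    (hS : ∀ (φ : G →* H) (u v : H), u ≠ v →
      (∀ z, z ≠ 1 → wordLength b u + wordLength a z < wordLength b (φ z * v)) → (φ, u, v) ∈ S) :
    IsGenericTriples a b S := by
  refine isGenericTuples_of_long_of_distinct_prefixes b fun p c hc hp t ht hlong hne => ?_
  have hlift : ∀ i, a.lift (fun i => t (Sum.inl i)) (a i) = t (Sum.inl i) := fun i =>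
    congrFun (a.lift.symm_apply_apply fun i => t (Sum.inl i)) i
  refine ⟨(a.lift fun i => t (Sum.inl i), t (Sum.inr 0), t (Sum.inr 1)),
    hS _ _ _ (fun h => ?_) fun z hz => ?_, ?_⟩
  · exact hne (Sum.inr 0, true) (Sum.inr 1, true) (by simp) (by simp [signedElement, h])
  · refine lt_of_le_of_lt (Nat.add_le_add_right (ht (Sum.inr 0)) _) ?_
    refine wordLength_map_mul_gt a b _ _ hc hp (fun i => ?_) (hlong _) (fun s s' h => ?_)
      (fun s => ?_) hz
    · rw [hlift]; exact hlong _
    · rw [hlift, hlift]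
      exact hne (Sum.inl s.1, s.2) (Sum.inl s'.1, s'.2) (by simpa [Prod.ext_iff] using h)
    · rw [hlift]
      exact hne (Sum.inl s.1, s.2) (Sum.inr 1, true) (by simp)
  · funext i
    rcases i with i | i
    · exact hlift i
    · fin_cases i <;> rfl

theorem mainTheorem3 {ι κ G H : Type*} [Group G] [Group H] [Fintype ι] [Fintype κ]
    (a : FreeGroupBasis ι G) (b : FreeGroupBasis κ H) (hH : 1 < Fintype.card κ) :
    IsGenericTriples b b {T : (H →* H) × H × H |
      singlyTwistedConjClass T.1 T.2.1 ≠ singlyTwistedConjClass T.1 T.2.2} ∧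
    IsGenericTriples a b {T : (G →* H) × H × H | T.2.1 * T.2.2⁻¹ ∉ T.1.range} := by
  have : Nontrivial κ := Fintype.one_lt_card_iff_nontrivial.1 hH
  constructor
  · refine isGenericTriples_of_wordLength_lt b b fun φ u v huv h hclass => ?_
    obtain ⟨z, hz⟩ : ∃ z : H, u = φ z * v * z⁻¹ := Quotient.exact hclass
    by_cases hz1 : z = 1
    · exact huv (by simpa [hz1] using hz)
    · have h₁ := h z hz1
      have h₂ : φ z * v = u * z := by rw [hz]; group
      rw [h₂] at h₁
      exact absurd (wordLength_mul_le b u z) (not_le.2 h₁)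
  · refine isGenericTriples_of_wordLength_lt a b fun φ u v huv h => ?_
    rintro ⟨z, hz⟩
    by_cases hz1 : z = 1
    · refine huv (mul_inv_eq_one.1 ?_)
      rw [← show φ z = u * v⁻¹ from hz, hz1, map_one]
    · have h₁ := h z hz1
      have h₂ : φ z * v = u := by rw [show φ z = u * v⁻¹ from hz]; group
      rw [h₂] at h₁
      omega
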